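/- Let $\mathbb{F}_q$ be a finite field. A $q$-matroid $M=(E,r)$ is a finite-dimensional $\mathbb{F}_q$-vector space $E$ together with an integer-valued function $r$ on the lattice of subspaces of $E$ such that $0\le r(A)\le\dim A$, $A\le B\Rightarrow r(A)\le r(B)$, and $r(A+B)+r(A\cap B)\le r(A)+r(B)$ for all subspaces $A,B\le E$; a subspace $A$ is independent if $r(A)=\dim A$. Two $q$-matroids $(E,r)$ and $(E',r')$ are isomorphic, written $\cong$, if there is an $\mathbb{F}_q$-linear isomorphism $\tau:E\to E'$ with $r'(\tau(V))=r(V)$ for all $V\le E$. A $q$-matroid is non-trivial if its ground space is non-zero. The free product $M_1\square M_2$ of $M_1=(E_1,r_1)$ and $M_2=(E_2,r_2)$ is the $q$-matroid on $E_1\oplus E_2$ whose independent spaces are exactly the subspaces $I\le E_1\oplus E_2$ such that $I_1:=\pi_1(I\cap (E_1\oplus 0))$ is independent in $M_1$ and $r_1(E_1)-r_1(I_1)\ge \dim\pi_2(I)-r_2(\pi_2(I))$, where $\pi_1,\pi_2$ are the coordinate projections. This operation is associative up to isomorphism; iterated products are bracketed from the right, and the empty product is the $q$-matroid on the zero space.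 A $q$-matroid is irreducible if it is non-trivial and is not isomorphic to a free product of two non-trivial $q$-matroids. Let $M$ be a $q$-matroid and suppose that $$M\cong M_1\square\cdots\square M_k\qquad\text{and}\qquad M\cong N_1\square\cdots\square N_r,$$ where all the $q$-matroids $M_1,\dots,M_k,N_1,\dots,N_r$ are irreducible. Then $k=r$ and $M_i\cong N_i$ for all $i\in\{1,\dots,k\}$. -/

import Mathlib

universe u v

/-- A `q`-matroid: a finite-dimensional vector space `E` over `F` (in the theorem, `F` is a finite
field) together with a rank function on the lattice of subspaces of `E` that is bounded by the
dimension, monotone and submodular. -/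
structure QMatroid (F : Type u) [Field F] where
  E : Type v
  [addCommGroup : AddCommGroup E]
  [module : Module F E]
  [finiteDimensional : FiniteDimensional F E]
  rank : Submodule F E → ℕ
  rank_le_finrank : ∀ A : Submodule F E, rank A ≤ Module.finrank F A
  rank_mono : ∀ A B : Submodule F E, A ≤ B → rank A ≤ rank B
  rank_submodular : ∀ A B : Submodule F E, rank (A ⊔ B) + rank (A ⊓ B) ≤ rank A + rank B

namespace QMatroid

attribute [instance] QMatroid.addCommGroup QMatroid.module QMatroid.finiteDimensional

variable {F : Type u} [Field F]

/-- A subspace is independent if its rank equals its dimension. -/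
def Indep (M : QMatroid.{u, v} F) (A : Submodule F M.E) : Prop :=
  M.rank A = Module.finrank F A

/-- The rank-lack `r(E) - r(A)`; the subtraction does not truncate, by monotonicity. -/
def rankLack (M : QMatroid.{u, v} F) (A : Submodule F M.E) : ℕ :=
  M.rank ⊤ - M.rank A

/-- The nullity `dim A - r(A)`; the subtraction does not truncate, by boundedness. -/
noncomputable def nullity (M : QMatroid.{u, v} F) (A : Submodule F M.E) : ℕ :=
  Module.finrank F A - M.rank A

/-- Isomorphism of `q`-matroids: a linear isomorphism of the ground spaces preserving the rank. -/
def Iso (M N : QMatroid.{u, v} F) : Prop :=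
  ∃ τ : M.E ≃ₗ[F] N.E, ∀ V : Submodule F M.E, N.rank (V.map (τ : M.E →ₗ[F] N.E)) = M.rank V

/-- A `q`-matroid is non-trivial if its ground space is not the zero space. -/
def IsNontrivial (M : QMatroid.{u, v} F) : Prop :=
  Nontrivial M.E

/-- For `I ≤ E₁ × E₂`, the subspace `π₁(I ∩ ι₁(E₁))` of `E₁`. -/
def fstPart (M₁ M₂ : QMatroid.{u, v} F) (I : Submodule F (M₁.E × M₂.E)) : Submodule F M₁.E :=
  (I ⊓ LinearMap.range (LinearMap.inl F M₁.E M₂.E)).map (LinearMap.fst F M₁.E M₂.E)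

/-- For `I ≤ E₁ × E₂`, the subspace `π₂(I)` of `E₂`. -/
def sndPart (M₁ M₂ : QMatroid.{u, v} F) (I : Submodule F (M₁.E × M₂.E)) : Submodule F M₂.E :=
  I.map (LinearMap.snd F M₁.E M₂.E)

/-- The collection of independent spaces that defines the free product. -/
def freeProdIndep (M₁ M₂ : QMatroid.{u, v} F) : Set (Submodule F (M₁.E × M₂.E)) :=
  {I | M₁.Indep (fstPart M₁ M₂ I) ∧
    M₂.nullity (sndPart M₁ M₂ I) ≤ M₁.rankLack (fstPart M₁ M₂ I)}

/-- The rank function defined by the collection `freeProdIndep`: the largest dimension of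
`X ∩ I` with `I` in the collection. -/
noncomputable def freeProdRank (M₁ M₂ : QMatroid.{u, v} F)
    (X : Submodule F (M₁.E × M₂.E)) : ℕ :=
  sSup {n : ℕ | ∃ I ∈ freeProdIndep M₁ M₂, n = Module.finrank F ↥(X ⊓ I)}

/-! Facts needed to see that `freeProdRank` is the rank function of a `q`-matroid. -/

theorem rank_le_add_of_le (M : QMatroid.{u, v} F) (A B : Submodule F M.E) (h : A ≤ B) :
    M.rank B + Module.finrank F A ≤ M.rank A + Module.finrank F B := by
  obtain ⟨C, hC⟩ := Submodule.exists_isCompl A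
  have h1 : A ⊔ (B ⊓ C) = B := by
    rw [inf_comm, ← sup_inf_assoc_of_le C h, hC.sup_eq_top, top_inf_eq]
  have h2 : A ⊓ (B ⊓ C) = ⊥ := by
    rw [← inf_assoc, inf_eq_left.2 h, hC.inf_eq_bot]
  have h3 := M.rank_submodular A (B ⊓ C)
  have h4 := Submodule.finrank_sup_add_finrank_inf_eq A (B ⊓ C)
  have h5 := M.rank_le_finrank (B ⊓ C)
  rw [h1] at h3 h4
  rw [h2] at h4
  simp at h4
  omega

theorem exists_indep (M : QMatroid.{u, v} F) (X : Submodule F M.E) :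
    ∃ I ≤ X, M.Indep I ∧ Module.finrank F I = M.rank X := by
  have hbot : M.Indep ⊥ := by
    have := M.rank_le_finrank ⊥
    simp only [finrank_bot, nonpos_iff_eq_zero] at this
    simp [Indep, this]
  obtain ⟨I, ⟨hIX, hI⟩, hmax⟩ :=
    exists_maximal_of_wellFoundedGT (fun I => I ≤ X ∧ M.Indep I) ⟨⊥, bot_le, hbot⟩
  obtain ⟨J, ⟨hIJ, hJX, hJ⟩, hmaxJ⟩ :=
    exists_maximal_of_wellFoundedGT (fun J => I ≤ J ∧ J ≤ X ∧ M.rank J = M.rank I)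
      ⟨I, le_rfl, hIX, rfl⟩
  refine ⟨I, hIX, hI, ?_⟩
  suffices h : X ≤ J by
    have := le_antisymm h hJX
    rw [← hI, ← hJ, this]
  intro x hx
  by_contra hxJ
  have hle : F ∙ x ≤ X := by simpa using hx
  have h1 : M.rank (I ⊔ F ∙ x) = M.rank I := by
    by_contra hne
    have h2 := M.rank_mono I (I ⊔ F ∙ x) le_sup_left
    have h3 := M.rank_le_finrank (I ⊔ F ∙ x)
    have h4 := Submodule.finrank_add_le_finrank_add_finrank I (F ∙ x)
    have h5 : Module.finrank F (F ∙ x) ≤ 1 := (finrank_span_le_card {x}).trans (by simp)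
    have h6 : Module.finrank F ↥(I ⊔ F ∙ x) ≤ Module.finrank F I + 1 := h4.trans (by omega)
    unfold Indep at hI
    have h7 : M.Indep (I ⊔ F ∙ x) := by unfold Indep; omega
    have h8 := hmax ⟨sup_le hIX hle, h7⟩ le_sup_left
    exact hxJ (hIJ (h8 (le_sup_right (a := I) (Submodule.mem_span_singleton_self x))))
  have h2 := M.rank_submodular J (I ⊔ F ∙ x)
  have h3 := M.rank_mono I (J ⊓ (I ⊔ F ∙ x)) (le_inf hIJ le_sup_left)
  have h4 := M.rank_mono I (J ⊔ (I ⊔ F ∙ x)) (hIJ.trans le_sup_left)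
  have h5 := hmaxJ (y := J ⊔ (I ⊔ F ∙ x)) ⟨hIJ.trans le_sup_left,
    sup_le hJX (sup_le hIX hle), by omega⟩ le_sup_left
  exact hxJ (h5 (le_sup_right (a := J)
    (le_sup_right (a := I) (Submodule.mem_span_singleton_self x))))

theorem Indep.mono {M : QMatroid.{u, v} F} {A B : Submodule F M.E} (hB : M.Indep B)
    (h : A ≤ B) : M.Indep A := by
  have h1 := M.rank_le_add_of_le A B h
  have h2 := M.rank_le_finrank A
  unfold Indep at *
  omega

theorem mem_fstPart (M₁ M₂ : QMatroid.{u, v} F) (I : Submodule F (M₁.E × M₂.E)) (x : M₁.E) :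
    x ∈ fstPart M₁ M₂ I ↔ (x, (0 : M₂.E)) ∈ I := by
  constructor
  · rintro ⟨_, ⟨h, y, rfl⟩, rfl⟩
    exact h
  · intro h
    exact ⟨_, ⟨h, x, rfl⟩, rfl⟩

theorem finrank_parts (M₁ M₂ : QMatroid.{u, v} F) (X : Submodule F (M₁.E × M₂.E)) :
    Module.finrank F (fstPart M₁ M₂ X) + Module.finrank F (sndPart M₁ M₂ X)
      = Module.finrank F X := by
  have h1 := LinearMap.finrank_range_add_finrank_ker
    ((LinearMap.snd F M₁.E M₂.E).domRestrict X)
  have h2 : LinearMap.range ((LinearMap.snd F M₁.E M₂.E).domRestrict X) = sndPart M₁ M₂ X :=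
    LinearMap.range_domRestrict _ _
  have h3 : (fstPart M₁ M₂ X).map (LinearMap.inl F M₁.E M₂.E) =
      (LinearMap.ker ((LinearMap.snd F M₁.E M₂.E).domRestrict X)).map X.subtype := by
    ext ⟨a, b⟩
    simp only [Submodule.mem_map, mem_fstPart, LinearMap.mem_ker]
    constructor
    · rintro ⟨y, hy, h⟩
      simp only [LinearMap.inl_apply, Prod.mk.injEq] at h
      obtain ⟨rfl, rfl⟩ := h
      exact ⟨⟨_, hy⟩, rfl, rfl⟩
    · rintro ⟨⟨⟨c, d⟩, hy⟩, h, h'⟩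
      simp only [Submodule.subtype_apply, Prod.mk.injEq] at h'
      obtain ⟨rfl, rfl⟩ := h'
      have hd : d = 0 := h
      subst hd
      exact ⟨c, hy, rfl⟩
  have h4 := LinearEquiv.finrank_eq (Submodule.equivMapOfInjective (LinearMap.inl F M₁.E M₂.E)
    LinearMap.inl_injective (fstPart M₁ M₂ X))
  rw [h3, Submodule.finrank_map_subtype_eq] at h4
  rw [h2] at h1
  omega

/-- The free product given by an explicit rank function; an auxiliary object, identified below with
the one given by `freeProdRank`. -/
noncomputable def freeProdAux (M₁ M₂ : QMatroid.{u, v} F) : QMatroid.{u, v} F where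
  E := M₁.E × M₂.E
  rank X := min (M₁.rank (fstPart M₁ M₂ X) + Module.finrank F (sndPart M₁ M₂ X))
    (M₁.rank ⊤ + M₂.rank (sndPart M₁ M₂ X))
  rank_le_finrank X := by
    have h1 := finrank_parts M₁ M₂ X
    have h2 := M₁.rank_le_finrank (fstPart M₁ M₂ X)
    omega
  rank_mono A B h := by
    have h1 : fstPart M₁ M₂ A ≤ fstPart M₁ M₂ B := Submodule.map_mono (inf_le_inf_right _ h)
    have h2 : sndPart M₁ M₂ A ≤ sndPart M₁ M₂ B := Submodule.map_mono h
    have h3 := M₁.rank_mono _ _ h1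
    have h4 := M₂.rank_mono _ _ h2
    have h5 := Submodule.finrank_mono h2
    omega
  rank_submodular A B := by
    have e1 : fstPart M₁ M₂ (A ⊓ B) = fstPart M₁ M₂ A ⊓ fstPart M₁ M₂ B := by
      ext x
      simp [mem_fstPart]
    have e2 : sndPart M₁ M₂ (A ⊔ B) = sndPart M₁ M₂ A ⊔ sndPart M₁ M₂ B := Submodule.map_sup _ _ _
    have e3 : sndPart M₁ M₂ (A ⊓ B) ≤ sndPart M₁ M₂ A ⊓ sndPart M₁ M₂ B := Submodule.map_inf_le _
    have e4 : fstPart M₁ M₂ A ⊔ fstPart M₁ M₂ B ≤ fstPart M₁ M₂ (A ⊔ B) :=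
      sup_le (Submodule.map_mono (inf_le_inf_right _ le_sup_left))
        (Submodule.map_mono (inf_le_inf_right _ le_sup_right))
    have d1 := finrank_parts M₁ M₂ A
    have d2 := finrank_parts M₁ M₂ B
    have d3 := finrank_parts M₁ M₂ (A ⊔ B)
    have d4 := finrank_parts M₁ M₂ (A ⊓ B)
    have d5 := Submodule.finrank_sup_add_finrank_inf_eq A B
    rw [e1] at d4 ⊢
    rw [e2] at d3 ⊢
    generalize fstPart M₁ M₂ A = A₁ at *
    generalize fstPart M₁ M₂ B = B₁ at *
    generalize sndPart M₁ M₂ A = A₂ at *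
    generalize sndPart M₁ M₂ B = B₂ at *
    generalize fstPart M₁ M₂ (A ⊔ B) = S₁ at *
    generalize sndPart M₁ M₂ (A ⊓ B) = T₂ at *
    have d6 := Submodule.finrank_sup_add_finrank_inf_eq A₁ B₁
    have d7 := Submodule.finrank_sup_add_finrank_inf_eq A₂ B₂
    have s1 := M₁.rank_submodular A₁ B₁
    have s2 := M₂.rank_submodular A₂ B₂
    have s3 := M₁.rank_le_add_of_le _ _ e4
    have s4 := M₂.rank_mono _ _ e3
    have s5 := M₂.rank_le_add_of_le A₂ (A₂ ⊔ B₂) le_sup_left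
    have s6 := M₂.rank_le_add_of_le B₂ (A₂ ⊔ B₂) le_sup_right
    have s7 := M₁.rank_mono (A₁ ⊓ B₁) A₁ inf_le_left
    have s8 := M₁.rank_mono (A₁ ⊓ B₁) B₁ inf_le_right
    have s9 := Submodule.finrank_mono e3
    rcases min_choice (M₁.rank A₁ + Module.finrank F A₂) (M₁.rank ⊤ + M₂.rank A₂) with h | h <;>
    rcases min_choice (M₁.rank B₁ + Module.finrank F B₂) (M₁.rank ⊤ + M₂.rank B₂) with h' | h' <;>
    rw [h, h'] <;> clear h h'
    · exact (add_le_add (min_le_left _ _) (min_le_left _ _)).trans (by omega)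
    · exact (add_le_add (min_le_right _ _) (min_le_left _ _)).trans (by omega)
    · exact (add_le_add (min_le_right _ _) (min_le_left _ _)).trans (by omega)
    · exact (add_le_add (min_le_right _ _) (min_le_right _ _)).trans (by omega)

theorem indep_freeProdAux (M₁ M₂ : QMatroid.{u, v} F) (I : Submodule F (M₁.E × M₂.E)) :
    (freeProdAux M₁ M₂).Indep I ↔ I ∈ freeProdIndep M₁ M₂ := by
  have h1 := finrank_parts M₁ M₂ I
  have h2 := M₁.rank_le_finrank (fstPart M₁ M₂ I)
  have h3 := M₁.rank_mono (fstPart M₁ M₂ I) ⊤ le_top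
  have h4 := M₂.rank_le_finrank (sndPart M₁ M₂ I)
  change min (M₁.rank (fstPart M₁ M₂ I) + Module.finrank F (sndPart M₁ M₂ I))
    (M₁.rank ⊤ + M₂.rank (sndPart M₁ M₂ I)) = Module.finrank F I ↔
    M₁.rank (fstPart M₁ M₂ I) = Module.finrank F (fstPart M₁ M₂ I) ∧
    Module.finrank F (sndPart M₁ M₂ I) - M₂.rank (sndPart M₁ M₂ I) ≤
      M₁.rank ⊤ - M₁.rank (fstPart M₁ M₂ I)
  omega

theorem freeProdRank_eq (M₁ M₂ : QMatroid.{u, v} F) (X : Submodule F (M₁.E × M₂.E)) :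
    freeProdRank M₁ M₂ X = (freeProdAux M₁ M₂).rank X := by
  refine IsGreatest.csSup_eq ⟨?_, ?_⟩
  · obtain ⟨I, hIX, hI, h⟩ := (freeProdAux M₁ M₂).exists_indep X
    refine ⟨I, (indep_freeProdAux M₁ M₂ I).1 hI, ?_⟩
    have h' : X ⊓ I = I := inf_eq_right.2 hIX
    exact h.symm.trans (congrArg (fun J : Submodule F (M₁.E × M₂.E) => Module.finrank F J) h'.symm)
  · rintro n ⟨I, hI, rfl⟩
    have h := ((indep_freeProdAux M₁ M₂ I).2 hI).mono (A := X ⊓ I) inf_le_right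
    exact h.symm.le.trans ((freeProdAux M₁ M₂).rank_mono (X ⊓ I) X inf_le_left)

/-- The free product of two `q`-matroids: the `q`-matroid on `E₁ ⊕ E₂` whose independent spaces
are those in `freeProdIndep`. -/
noncomputable def freeProd (M₁ M₂ : QMatroid.{u, v} F) : QMatroid.{u, v} F where
  E := M₁.E × M₂.E
  rank := freeProdRank M₁ M₂
  rank_le_finrank A := by
    rw [freeProdRank_eq]
    exact (freeProdAux M₁ M₂).rank_le_finrank A
  rank_mono A B h := by
    rw [freeProdRank_eq, freeProdRank_eq]
    exact (freeProdAux M₁ M₂).rank_mono A B h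
  rank_submodular A B := by
    simp only [freeProdRank_eq]
    exact (freeProdAux M₁ M₂).rank_submodular A B

theorem indep_freeProd_iff (M₁ M₂ : QMatroid.{u, v} F) (I : Submodule F (M₁.E × M₂.E)) :
    (freeProd M₁ M₂).Indep I ↔ I ∈ freeProdIndep M₁ M₂ := by
  rw [← indep_freeProdAux]
  change freeProdRank M₁ M₂ I = _ ↔ _
  rw [freeProdRank_eq]
  rfl

/-- The `q`-matroid on the zero space. -/
def trivialQMatroid (F : Type u) [Field F] : QMatroid.{u, v} F where
  E := PUnit
  rank _ := 0
  rank_le_finrank _ := Nat.zero_le _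
  rank_mono _ _ _ := le_rfl
  rank_submodular _ _ := le_rfl

/-- The iterated free product `M₁ □ (M₂ □ (⋯ □ Mₖ))`; the empty product is the `q`-matroid on the
zero space. -/
noncomputable def freeProdList : List (QMatroid.{u, v} F) → QMatroid.{u, v} F
  | [] => trivialQMatroid F
  | [M] => M
  | M :: N :: l => freeProd M (freeProdList (N :: l))

/-- A `q`-matroid on a non-zero space is irreducible if it is not (isomorphic to) the free product
of two non-trivial `q`-matroids. -/
def IsIrreducible (M : QMatroid.{u, v} F) : Prop :=
  M.IsNontrivial ∧ ∀ M₁ M₂ : QMatroid.{u, v} F,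
    M₁.IsNontrivial → M₂.IsNontrivial → ¬ M.Iso (freeProd M₁ M₂)

end QMatroid

namespace QMatroid

variable {F : Type u} [Field F]

/-! A factorization `M ≅ M₁ □ M₂` is recorded inside `M` by one subspace, the image `A` of `E₁`. It
satisfies `r(X) = min (r(X ∩ A) + dim (X + A) - dim A) (r(X + A))` for all `X`; `IsFreeSep` states
this with `dim A` added to both sides, so that no natural subtraction occurs. Conversely such an `A`
gives `M ≅ M|A □ M/A`, so an irreducible `q`-matroid has only the free separators `⊥` and `⊤`.

The heart is the comparison of two free separators `A`, `B` with irreducible restrictions. As `A ∩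
B` is a free separator of both restrictions, either `A = B` or `A ∩ B = 0`. In the latter case the
restrictions are uniform, and an irreducible uniform `q`-matroid has dimension one. The rank of `X`
is then determined by `dim X` and `X + A + B`, so a transvection carrying the line `A` to the line
`B` is an automorphism of `M` (`exists_automorphism`). Thus first factors can be matched and
cancelled (`freeProd_cancel`), and induction on the list of factors finishes. -/

/-! ### Isomorphisms and the rank formula of the free product -/

theorem Iso.symm {M N : QMatroid.{u, v} F} (h : M.Iso N) : N.Iso M := by
  obtain ⟨τ, hτ⟩ := h
  refine ⟨τ.symm, fun V => ?_⟩
  rw [← hτ, ← Submodule.map_comp]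
  simp

theorem Iso.trans {M N P : QMatroid.{u, v} F} (h : M.Iso N) (h' : N.Iso P) : M.Iso P := by
  obtain ⟨τ, hτ⟩ := h
  obtain ⟨σ, hσ⟩ := h'
  refine ⟨τ.trans σ, fun V => ?_⟩
  rw [← hτ, ← hσ, ← Submodule.map_comp]
  rfl

theorem IsIrreducible.of_iso {M N : QMatroid.{u, v} F} (hM : M.IsIrreducible) (h : M.Iso N) :
    N.IsIrreducible := by
  refine ⟨?_, fun M₁ M₂ h₁ h₂ h' => hM.2 M₁ M₂ h₁ h₂ (h.trans h')⟩
  obtain ⟨τ, -⟩ := h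
  have : Nontrivial M.E := hM.1
  exact τ.symm.toEquiv.nontrivial

theorem freeProdRank_eq_min (M₁ M₂ : QMatroid.{u, v} F) (X : Submodule F (M₁.E × M₂.E)) :
    freeProdRank M₁ M₂ X =
      min (M₁.rank (fstPart M₁ M₂ X) + Module.finrank F (sndPart M₁ M₂ X))
        (M₁.rank ⊤ + M₂.rank (sndPart M₁ M₂ X)) :=
  freeProdRank_eq M₁ M₂ X

/-! ### Restriction and contraction -/

/-- The restriction of a `q`-matroid to a subspace. -/
abbrev restrict (M : QMatroid.{u, v} F) (A : Submodule F M.E) : QMatroid.{u, v} F where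
  E := A
  rank X := M.rank (X.map A.subtype)
  rank_le_finrank X := by
    rw [← Submodule.finrank_map_subtype_eq A X]
    exact M.rank_le_finrank _
  rank_mono X Y h := M.rank_mono _ _ (Submodule.map_mono h)
  rank_submodular X Y := by
    rw [Submodule.map_sup, Submodule.map_inf _ A.injective_subtype]
    exact M.rank_submodular _ _

theorem finrank_comap_mkQ {E : Type v} [AddCommGroup E] [Module F E] [FiniteDimensional F E]
    (A : Submodule F E) (X : Submodule F (E ⧸ A)) :
    Module.finrank F (X.comap A.mkQ) = Module.finrank F X + Module.finrank F A := by
  have h := LinearMap.finrank_range_add_finrank_ker (A.mkQ.domRestrict (X.comap A.mkQ))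
  rw [LinearMap.range_domRestrict, Submodule.map_comap_eq_of_surjective A.mkQ_surjective] at h
  rw [← h]
  congr 1
  rw [← Submodule.finrank_map_subtype_eq, LinearMap.ker_domRestrict]
  rw [Submodule.map_comap_subtype, Submodule.ker_mkQ, inf_eq_right.2 (A.le_comap_mkQ X)]

/-- The contraction of a `q`-matroid by a subspace. -/
abbrev contract (M : QMatroid.{u, v} F) (A : Submodule F M.E) : QMatroid.{u, v} F where
  E := M.E ⧸ A
  rank X := M.rank (X.comap A.mkQ) - M.rank A
  rank_le_finrank X := by
    have h := M.rank_le_add_of_le _ _ (A.le_comap_mkQ X)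
    rw [finrank_comap_mkQ] at h
    omega
  rank_mono X Y h := Nat.sub_le_sub_right (M.rank_mono _ _ (Submodule.comap_mono h)) _
  rank_submodular X Y := by
    have h := M.rank_submodular (X.comap A.mkQ) (Y.comap A.mkQ)
    have e : X.comap A.mkQ ⊔ Y.comap A.mkQ = (X ⊔ Y).comap A.mkQ := by
      refine le_antisymm (sup_le (Submodule.comap_mono le_sup_left)
        (Submodule.comap_mono le_sup_right)) fun x hx => ?_
      obtain ⟨y, hy, z, hz, h'⟩ := Submodule.mem_sup.1 hx
      obtain ⟨y, rfl⟩ := A.mkQ_surjective y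
      refine Submodule.mem_sup.2 ⟨y, hy, x - y, ?_, by simp⟩
      rw [Submodule.mem_comap, map_sub, ← h', add_sub_cancel_left]
      exact hz
    rw [← Submodule.comap_inf, e] at h
    have h₁ := M.rank_mono _ _ (A.le_comap_mkQ X)
    have h₂ := M.rank_mono _ _ (A.le_comap_mkQ Y)
    have h₃ := M.rank_mono _ _ (A.le_comap_mkQ (X ⊓ Y))
    have h₄ := M.rank_mono _ _ (A.le_comap_mkQ (X ⊔ Y))
    omega

theorem restrict_iso_of_map_eq {M N : QMatroid.{u, v} F} (τ : M.E ≃ₗ[F] N.E)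
    (hτ : ∀ V : Submodule F M.E, N.rank (V.map (τ : M.E →ₗ[F] N.E)) = M.rank V)
    {A : Submodule F M.E} {B : Submodule F N.E} (h : A.map (τ : M.E →ₗ[F] N.E) = B) :
    (M.restrict A).Iso (N.restrict B) := by
  subst h
  refine ⟨τ.submoduleMap A, fun V => ?_⟩
  refine Eq.trans ?_ (hτ (V.map A.subtype))
  change N.rank _ = N.rank _
  rw [← Submodule.map_comp, ← Submodule.map_comp]
  rfl

theorem contract_iso_of_map_eq {M N : QMatroid.{u, v} F} (τ : M.E ≃ₗ[F] N.E)
    (hτ : ∀ V : Submodule F M.E, N.rank (V.map (τ : M.E →ₗ[F] N.E)) = M.rank V)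
    {A : Submodule F M.E} {B : Submodule F N.E} (h : A.map (τ : M.E →ₗ[F] N.E) = B) :
    (M.contract A).Iso (N.contract B) := by
  refine ⟨Submodule.Quotient.equiv A B τ h, fun V => ?_⟩
  change N.rank _ - N.rank B = M.rank _ - M.rank A
  subst h
  rw [hτ A, ← hτ (V.comap A.mkQ)]
  congr 2
  ext x
  simp only [Submodule.mem_comap, Submodule.mem_map]
  constructor
  · rintro ⟨y, hy, hyx⟩
    refine ⟨τ.symm x, ?_, by simp⟩
    have : y = A.mkQ (τ.symm x) := by
      apply (Submodule.Quotient.equiv A (A.map (τ : M.E →ₗ[F] N.E)) τ rfl).injective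
      refine hyx.trans ?_
      simp
    rwa [← this]
  · rintro ⟨y, hy, rfl⟩
    exact ⟨_, hy, rfl⟩

/-! ### Free separators and factorizations -/

/-- A subspace `A` such that the `q`-matroid is the free product of its restriction to `A` and its
contraction by `A`. -/
def IsFreeSep (M : QMatroid.{u, v} F) (A : Submodule F M.E) : Prop :=
  ∀ X : Submodule F M.E, M.rank X + Module.finrank F A =
    min (M.rank (X ⊓ A) + Module.finrank F ↥(X ⊔ A)) (M.rank (X ⊔ A) + Module.finrank F A)

theorem IsFreeSep.map {M N : QMatroid.{u, v} F} (τ : M.E ≃ₗ[F] N.E)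
    (hτ : ∀ V : Submodule F M.E, N.rank (V.map (τ : M.E →ₗ[F] N.E)) = M.rank V)
    {A : Submodule F M.E} (h : M.IsFreeSep A) : N.IsFreeSep (A.map (τ : M.E →ₗ[F] N.E)) := by
  intro X
  obtain ⟨Y, rfl⟩ : ∃ Y : Submodule F M.E, Y.map (τ : M.E →ₗ[F] N.E) = X :=
    ⟨X.comap (τ : M.E →ₗ[F] N.E), Submodule.map_comap_eq_of_surjective τ.surjective X⟩
  rw [← Submodule.map_sup, ← Submodule.map_inf _ τ.injective, hτ, hτ, hτ,
    LinearEquiv.finrank_map_eq, LinearEquiv.finrank_map_eq]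
  exact h Y

theorem IsFreeSep.iso_freeProd {M : QMatroid.{u, v} F} {A : Submodule F M.E}
    (h : M.IsFreeSep A) : M.Iso (freeProd (M.restrict A) (M.contract A)) := by
  -- Any complement will do: the rank of `V` depends only on `V ∩ A` and `V + A`, which correspond
  -- to `fstPart` and `sndPart`.
  obtain ⟨C, hC⟩ := Submodule.exists_isCompl A
  let τ : (A × (M.E ⧸ A)) ≃ₗ[F] M.E :=
    ((LinearEquiv.refl F A).prodCongr (Submodule.quotientEquivOfIsCompl A C hC)).trans
      (Submodule.prodEquivOfIsCompl A C hC)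
  have hτ (a : A) (q : M.E ⧸ A) : A.mkQ (τ (a, q)) = q := by
    simp [τ]
  have hτ' (a : A) : τ (a, 0) = a := by
    simp [τ]
  refine Iso.symm ⟨τ, fun (V : Submodule F (A × (M.E ⧸ A))) => ?_⟩
  change M.rank (V.map (τ : _ →ₗ[F] M.E)) = freeProdRank (M.restrict A) (M.contract A) V
  rw [freeProdRank_eq_min]
  have e₁ : V.map (τ : _ →ₗ[F] M.E) ⊓ A =
      (fstPart (M.restrict A) (M.contract A) V).map A.subtype := by
    ext x
    simp only [Submodule.mem_inf, Submodule.mem_map]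
    constructor
    · rintro ⟨⟨⟨a, q⟩, hV, rfl⟩, hA⟩
      have hq : q = 0 := by
        rw [← hτ a q]
        simpa using hA
      subst hq
      exact ⟨a, (mem_fstPart (M.restrict A) (M.contract A) V a).2 hV, (hτ' a).symm⟩
    · rintro ⟨a, ha, rfl⟩
      exact ⟨⟨(a, 0), (mem_fstPart (M.restrict A) (M.contract A) V a).1 ha, hτ' a⟩, a.2⟩
  have e₂ : V.map (τ : _ →ₗ[F] M.E) ⊔ A =
      (sndPart (M.restrict A) (M.contract A) V).comap A.mkQ := by
    have : sndPart (M.restrict A) (M.contract A) V =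
        (V.map (τ : _ →ₗ[F] M.E)).map A.mkQ := by
      rw [← Submodule.map_comp]
      refine congrArg (fun f => Submodule.map f V) ?_
      exact LinearMap.ext fun x => (hτ x.1 x.2).symm
    rw [this, Submodule.comap_map_mkQ, sup_comm]
  have h₁ := h (V.map (τ : _ →ₗ[F] M.E))
  have h₂ := M.rank_mono _ _ (A.le_comap_mkQ (sndPart (M.restrict A) (M.contract A) V))
  have h₃ : (M.restrict A).rank ⊤ = M.rank A :=
    congrArg M.rank (Submodule.map_subtype_top A)
  have h₄ : Module.finrank F ((sndPart (M.restrict A) (M.contract A) V).comap A.mkQ) =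
      Module.finrank F (sndPart (M.restrict A) (M.contract A) V) + Module.finrank F A :=
    finrank_comap_mkQ A (sndPart (M.restrict A) (M.contract A) V)
  have h₅ : (M.contract A).rank (sndPart (M.restrict A) (M.contract A) V) = M.rank
    ((sndPart (M.restrict A) (M.contract A) V).comap A.mkQ) - M.rank A := rfl
  have h₆ : (M.restrict A).rank (fstPart (M.restrict A) (M.contract A) V) =
    M.rank ((fstPart (M.restrict A) (M.contract A) V).map A.subtype) := rfl
  rw [e₁, e₂, h₄] at h₁
  rw [h₃, h₅, h₆]
  omega

theorem IsFreeSep.eq_bot_or_eq_top {M : QMatroid.{u, v} F} (hM : M.IsIrreducible)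
    {A : Submodule F M.E} (h : M.IsFreeSep A) : A = ⊥ ∨ A = ⊤ := by
  by_contra! hA
  refine hM.2 _ _ ?_ ?_ h.iso_freeProd
  · exact Submodule.nontrivial_iff_ne_bot.2 hA.1
  · exact Submodule.Quotient.nontrivial_iff.2 hA.2

/-! ### The first factor as a free separator of the product -/

theorem fstPart_of_ker_le {M₁ M₂ : QMatroid.{u, v} F} {X : Submodule F (M₁.E × M₂.E)}
    (h : LinearMap.ker (LinearMap.snd F M₁.E M₂.E) ≤ X) : fstPart M₁ M₂ X = ⊤ :=
  Submodule.eq_top_iff'.2 fun x => (mem_fstPart M₁ M₂ X x).2 (h (by simp))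

theorem freeProdRank_of_ker_le {M₁ M₂ : QMatroid.{u, v} F} {X : Submodule F (M₁.E × M₂.E)}
    (h : LinearMap.ker (LinearMap.snd F M₁.E M₂.E) ≤ X) :
    freeProdRank M₁ M₂ X = M₁.rank ⊤ + M₂.rank (X.map (LinearMap.snd F M₁.E M₂.E)) := by
  rw [freeProdRank_eq_min, fstPart_of_ker_le h]
  exact min_eq_right (Nat.add_le_add_left (M₂.rank_le_finrank _) _)

theorem freeProdRank_map_inl (M₁ M₂ : QMatroid.{u, v} F) (V : Submodule F M₁.E) :
    freeProdRank M₁ M₂ (V.map (LinearMap.inl F M₁.E M₂.E)) = M₁.rank V := by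
  have h₁ : fstPart M₁ M₂ (V.map (LinearMap.inl F M₁.E M₂.E)) = V := by
    ext x
    simp [mem_fstPart]
  have h₂ : sndPart M₁ M₂ (V.map (LinearMap.inl F M₁.E M₂.E)) = ⊥ := by
    rw [sndPart, ← Submodule.map_comp, LinearMap.snd_comp_inl, Submodule.map_zero]
  rw [freeProdRank_eq_min, h₁, h₂, finrank_bot]
  have := M₁.rank_mono V ⊤ le_top
  omega

theorem freeProdRank_ker_snd (M₁ M₂ : QMatroid.{u, v} F) :
    freeProdRank M₁ M₂ (LinearMap.ker (LinearMap.snd F M₁.E M₂.E)) = M₁.rank ⊤ := by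
  rw [← LinearMap.range_inl, ← Submodule.map_top]
  exact freeProdRank_map_inl M₁ M₂ ⊤

theorem isFreeSep_ker_snd (M₁ M₂ : QMatroid.{u, v} F) :
    (freeProd M₁ M₂).IsFreeSep (LinearMap.ker (LinearMap.snd F M₁.E M₂.E)) := by
  intro (X : Submodule F (M₁.E × M₂.E))
  set K := LinearMap.ker (LinearMap.snd F M₁.E M₂.E) with hK
  have e₁ : X ⊓ K = (fstPart M₁ M₂ X).map (LinearMap.inl F M₁.E M₂.E) := by
    ext ⟨a, b⟩
    simp only [Submodule.mem_inf, Submodule.mem_map, mem_fstPart, hK, LinearMap.mem_ker,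
      LinearMap.snd_apply, LinearMap.inl_apply, Prod.mk.injEq]
    constructor
    · rintro ⟨h, rfl⟩
      exact ⟨a, h, rfl, rfl⟩
    · rintro ⟨a, h, rfl, rfl⟩
      exact ⟨h, rfl⟩
  have e₂ : (X ⊔ K).map (LinearMap.snd F M₁.E M₂.E) = sndPart M₁ M₂ X := by
    have : K.map (LinearMap.snd F M₁.E M₂.E) = ⊥ :=
      LinearMap.le_ker_iff_map.1 le_rfl
    rw [Submodule.map_sup, this, sup_bot_eq]
    rfl
  have h₁ := freeProdRank_map_inl M₁ M₂ (fstPart M₁ M₂ X)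
  have h₂ := freeProdRank_of_ker_le (M₁ := M₁) (M₂ := M₂) (le_sup_right : K ≤ X ⊔ K)
  have h₃ := freeProdRank_eq_min M₁ M₂ X
  have h₄ := finrank_parts M₁ M₂ X
  have h₅ := Submodule.finrank_sup_add_finrank_inf_eq X K
  have h₆ := LinearEquiv.finrank_eq (Submodule.equivMapOfInjective
    (LinearMap.inl F M₁.E M₂.E) LinearMap.inl_injective (fstPart M₁ M₂ X))
  rw [← e₁] at h₁ h₆
  rw [e₂] at h₂
  change freeProdRank M₁ M₂ X + Module.finrank F K = min
    (freeProdRank M₁ M₂ (X ⊓ K) + Module.finrank F ↥(X ⊔ K))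
    (freeProdRank M₁ M₂ (X ⊔ K) + Module.finrank F K)
  omega

theorem restrict_freeProd_iso (M₁ M₂ : QMatroid.{u, v} F) :
    ((freeProd M₁ M₂).restrict (LinearMap.ker (LinearMap.snd F M₁.E M₂.E))).Iso M₁ := by
  refine Iso.symm ⟨(LinearEquiv.ofInjective (LinearMap.inl F M₁.E M₂.E)
    LinearMap.inl_injective).trans (LinearEquiv.ofEq _ _ (LinearMap.range_inl F M₁.E M₂.E)),
    fun V => ?_⟩
  rw [← freeProdRank_map_inl M₁ M₂ V]
  refine congrArg (freeProdRank M₁ M₂) ?_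
  exact (Submodule.map_comp _ _ V).symm

theorem contract_freeProd_iso (M₁ M₂ : QMatroid.{u, v} F) :
    ((freeProd M₁ M₂).contract (LinearMap.ker (LinearMap.snd F M₁.E M₂.E))).Iso M₂ := by
  set K := LinearMap.ker (LinearMap.snd F M₁.E M₂.E)
  let e := (LinearMap.snd F M₁.E M₂.E).quotKerEquivOfSurjective LinearMap.snd_surjective
  refine ⟨e, fun (V : Submodule F ((M₁.E × M₂.E) ⧸ K)) => ?_⟩
  change _ = freeProdRank M₁ M₂ (V.comap K.mkQ) - freeProdRank M₁ M₂ K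
  rw [freeProdRank_ker_snd, freeProdRank_of_ker_le (K.le_comap_mkQ V), Nat.add_sub_cancel_left]
  have h : (V.comap K.mkQ).map ((e : _ →ₗ[F] M₂.E) ∘ₗ K.mkQ) = V.map (e : _ →ₗ[F] M₂.E) := by
    rw [Submodule.map_comp, Submodule.map_comap_eq_of_surjective K.mkQ_surjective]
  exact congrArg M₂.rank h.symm

/-! ### Comparing two free separators -/

/-- For `X ≤ A`, replacing `B` by `A ∩ B` changes neither `X ∩ B` nor the codimension of `X ∩ B` in
`X`. The other term of the minimum is squeezed: `r(X) ≤ r(X + A ∩ B) ≤ r(X + B)`. -/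
theorem IsFreeSep.restrict {M : QMatroid.{u, v} F} {B : Submodule F M.E} (hB : M.IsFreeSep B)
    (A : Submodule F M.E) : (M.restrict A).IsFreeSep (B.comap A.subtype) := by
  intro (X : Submodule F A)
  change M.rank _ + Module.finrank F (B.comap A.subtype) = min (M.rank (Submodule.map _ _) +
    Module.finrank F ↥(X ⊔ B.comap A.subtype)) (M.rank (Submodule.map _ _) + _)
  rw [← Submodule.finrank_map_subtype_eq A (B.comap A.subtype),
    ← Submodule.finrank_map_subtype_eq A (X ⊔ B.comap A.subtype), Submodule.map_sup,
    Submodule.map_inf _ A.injective_subtype, Submodule.map_comap_subtype]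
  have hX : X.map A.subtype ≤ A := A.map_subtype_le X
  generalize X.map A.subtype = X at hX
  have h₁ := hB X
  have h₂ := M.rank_mono X (X ⊔ A ⊓ B) le_sup_left
  have h₃ := M.rank_mono (X ⊔ A ⊓ B) (X ⊔ B) (sup_le_sup_left inf_le_right X)
  have e : X ⊓ (A ⊓ B) = X ⊓ B := by rw [← inf_assoc, inf_eq_left.2 hX]
  have h₄ := Submodule.finrank_sup_add_finrank_inf_eq X (A ⊓ B)
  have h₅ := Submodule.finrank_sup_add_finrank_inf_eq X B
  have h₆ := M.rank_le_add_of_le (X ⊓ B) X inf_le_left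
  rw [e] at h₄ ⊢
  omega

/-- The condition for `B` at `X` gives `r(X) = min (dim X) (r(X + B))`, and the one for `A` at `X +
B` gives `r(X + B) = min (r(X) + dim B) (r(A + B))`. Since `dim B > 0`, the term `r(X) + dim B`
cannot attain the minimum for `r(X)`. So `r(X) < dim X` forces `r(X) = r(A + B) ≥ r(A)`. -/
theorem IsFreeSep.rank_eq_min_of_inf_eq_bot {M : QMatroid.{u, v} F} {A B : Submodule F M.E}
    (hA : M.IsFreeSep A) (hB : M.IsFreeSep B) (hAB : A ⊓ B = ⊥) (hB₀ : B ≠ ⊥)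
    {X : Submodule F M.E} (hX : X ≤ A) :
    M.rank X = min (Module.finrank F X) (M.rank A) := by
  have h₁ := hB X
  have h₂ := hA (X ⊔ B)
  have e₁ : X ⊓ B = ⊥ := le_bot_iff.1 ((inf_le_inf_right B hX).trans hAB.le)
  have e₂ : (X ⊔ B) ⊓ A = X := by
    rw [sup_inf_assoc_of_le B hX, inf_comm, hAB, sup_bot_eq]
  have e₃ : X ⊔ B ⊔ A = A ⊔ B := by
    rw [sup_right_comm, sup_eq_right.2 hX]
  have h₃ := Submodule.finrank_sup_add_finrank_inf_eq X B
  have h₄ := Submodule.finrank_sup_add_finrank_inf_eq A B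
  have h₅ : 0 < Module.finrank F B := by
    rwa [Nat.pos_iff_ne_zero, Ne, Submodule.finrank_eq_zero]
  have h₆ := M.rank_mono X A hX
  have h₇ := M.rank_mono A (A ⊔ B) le_sup_left
  have h₈ := M.rank_le_finrank X
  have h₉ := M.rank_le_finrank ⊥
  rw [e₁] at h₁ h₃
  rw [e₂, e₃] at h₂
  rw [hAB] at h₄
  rw [finrank_bot] at *
  omega

/-- By modularity `dim (X ∩ A) + dim (X + A) - dim A = dim X`; the remaining terms in the minimum
are at least `dim X` or at least `r(E)`. -/
theorem isFreeSep_of_uniform {M : QMatroid.{u, v} F}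
    (h : ∀ X : Submodule F M.E, M.rank X = min (Module.finrank F X) (M.rank ⊤))
    (A : Submodule F M.E) : M.IsFreeSep A := by
  intro X
  have h₀ := h X
  have h₃ := h (X ⊓ A)
  have h₄ := h (X ⊔ A)
  have h₅ := Submodule.finrank_mono (inf_le_left : X ⊓ A ≤ X)
  have h₆ := Submodule.finrank_mono (inf_le_right : X ⊓ A ≤ A)
  have h₁ := Submodule.finrank_sup_add_finrank_inf_eq X A
  have h₂ := Submodule.finrank_mono (le_sup_right : A ≤ X ⊔ A)
  omega

theorem finrank_eq_one_of_uniform {M : QMatroid.{u, v} F} (hM : M.IsIrreducible)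
    (h : ∀ X : Submodule F M.E, M.rank X = min (Module.finrank F X) (M.rank ⊤)) :
    Module.finrank F M.E = 1 := by
  have : Nontrivial M.E := hM.1
  obtain ⟨x, hx⟩ := exists_ne (0 : M.E)
  -- A line is a nonzero free separator, hence the whole space.
  rcases (isFreeSep_of_uniform h (F ∙ x)).eq_bot_or_eq_top hM with h' | h'
  · exact absurd (Submodule.span_singleton_eq_bot.1 h') hx
  · rw [← finrank_top, ← h', finrank_span_singleton hx]

theorem IsFreeSep.finrank_eq_one {M : QMatroid.{u, v} F} {A B : Submodule F M.E}
    (hA : M.IsFreeSep A) (hB : M.IsFreeSep B) (hAB : A ⊓ B = ⊥) (hB₀ : B ≠ ⊥)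
    (hA' : (M.restrict A).IsIrreducible) : Module.finrank F A = 1 := by
  refine finrank_eq_one_of_uniform hA' fun (X : Submodule F A) => ?_
  have h := hA.rank_eq_min_of_inf_eq_bot hB hAB hB₀ (A.map_subtype_le X)
  rw [Submodule.finrank_map_subtype_eq] at h
  have h' : (M.restrict A).rank ⊤ = M.rank A := congrArg M.rank (Submodule.map_subtype_top A)
  rw [h']
  exact h

/-- A free separator of dimension one consists of loops or imposes no constraint. -/
theorem IsFreeSep.rank_eq_of_finrank_eq_one {M : QMatroid.{u, v} F} {A : Submodule F M.E}
    (hA : M.IsFreeSep A) (h : Module.finrank F A = 1) (X : Submodule F M.E) :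
    M.rank X = if M.rank A = 0 then M.rank (X ⊔ A)
      else min (Module.finrank F X) (M.rank (X ⊔ A)) := by
  have h₁ := M.rank_submodular X A
  have h₂ := M.rank_mono X (X ⊔ A) le_sup_left
  have h₃ := M.rank_le_finrank A
  have h₄ := M.rank_le_finrank X
  have h₅ := hA X
  have h₆ := Submodule.finrank_sup_add_finrank_inf_eq X A
  have h₇ := Submodule.finrank_mono (inf_le_right : X ⊓ A ≤ A)
  have h₈ := M.rank_le_finrank (X ⊓ A)
  have h₉ : Module.finrank F ↥(X ⊓ A) = 1 → X ⊓ A = A := fun h' =>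
    Submodule.eq_of_le_of_finrank_eq inf_le_right (h'.trans h.symm)
  split_ifs with h₀
  · omega
  · by_cases h' : Module.finrank F ↥(X ⊓ A) = 1
    · have h'' : X ⊔ A = X := sup_eq_left.2 (inf_eq_right.1 (h₉ h'))
      rw [h'']
      omega
    · omega

/-- The factorization determines its first subspace only up to an automorphism of `M`: two distinct
lines can both occur, and a transvection then exchanges one for the other. -/
theorem exists_automorphism {M : QMatroid.{u, v} F} {A B : Submodule F M.E}
    (hA : M.IsFreeSep A) (hB : M.IsFreeSep B) (hA' : (M.restrict A).IsIrreducible)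
    (hB' : (M.restrict B).IsIrreducible) :
    ∃ τ : M.E ≃ₗ[F] M.E, A.map (τ : M.E →ₗ[F] M.E) = B ∧
      ∀ V : Submodule F M.E, M.rank (V.map (τ : M.E →ₗ[F] M.E)) = M.rank V := by
  have hA₀ : A ≠ ⊥ := Submodule.nontrivial_iff_ne_bot.1 hA'.1
  have hB₀ : B ≠ ⊥ := Submodule.nontrivial_iff_ne_bot.1 hB'.1
  have key : A ⊓ B = ⊥ ∨ A = B := by
    rcases (hB.restrict A).eq_bot_or_eq_top hA' with h | h
    · left
      have h' := congrArg (Submodule.map A.subtype) h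
      rwa [Submodule.map_comap_subtype, Submodule.map_bot] at h'
    rcases (hA.restrict B).eq_bot_or_eq_top hB' with h' | h'
    · left
      have h'' := congrArg (Submodule.map B.subtype) h'
      rwa [Submodule.map_comap_subtype, Submodule.map_bot, inf_comm] at h''
    · exact Or.inr (le_antisymm (Submodule.comap_subtype_eq_top.1 h)
        (Submodule.comap_subtype_eq_top.1 h'))
  rcases key with hAB | rfl
  swap
  · exact ⟨LinearEquiv.refl F M.E, Submodule.map_id A, fun V => congrArg _ (Submodule.map_id V)⟩
  have dA := hA.finrank_eq_one hB hAB hB₀ hA'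
  have dB := hB.finrank_eq_one hA (inf_comm B A ▸ hAB) hA₀ hB'
  -- Each of the two ranks equals `min 1 (r(A + B))`.
  have hr : M.rank A = 0 ↔ M.rank B = 0 := by
    have h₁ := hA B
    have h₂ := hB A
    have h₃ := Submodule.finrank_sup_add_finrank_inf_eq A B
    have h₄ := M.rank_le_finrank ⊥
    rw [inf_comm B A, sup_comm B A] at h₁
    rw [hAB] at h₁ h₂ h₃
    rw [finrank_bot] at *
    omega
  -- The one-dimensional formula is applied to `A` at `X` and then to `B` at `X + A`; the bound `dim
  -- (X + A)` is absorbed by `dim X`.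
  have hrank (X : Submodule F M.E) : M.rank X = if M.rank A = 0 then M.rank (X ⊔ (A ⊔ B))
      else min (Module.finrank F X) (M.rank (X ⊔ (A ⊔ B))) := by
    have h₁ := hA.rank_eq_of_finrank_eq_one dA X
    have h₂ := hB.rank_eq_of_finrank_eq_one dB (X ⊔ A)
    have h₃ := Submodule.finrank_mono (le_sup_left : X ≤ X ⊔ A)
    rw [sup_assoc] at h₂
    split_ifs at * <;> omega
  obtain ⟨a, ha, ha₀⟩ := Submodule.exists_mem_ne_zero_of_ne_bot hA₀
  obtain ⟨b, hb, hb₀⟩ := Submodule.exists_mem_ne_zero_of_ne_bot hB₀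
  have eA : F ∙ a = A := Submodule.eq_of_le_of_finrank_eq (by simpa using ha)
    ((finrank_span_singleton ha₀).trans dA.symm)
  have eB : F ∙ b = B := Submodule.eq_of_le_of_finrank_eq (by simpa using hb)
    ((finrank_span_singleton hb₀).trans dB.symm)
  have hdisj {x : M.E} (h₁ : x ∈ A) (h₂ : x ∈ B) : x = 0 :=
    (Submodule.mem_bot F).1 (hAB ▸ Submodule.mem_inf.2 ⟨h₁, h₂⟩)
  -- This provides a functional `g` with `g (b - a) = 0` and `g a ≠ 0`; scaled to take the value 1
  -- at `a`, it defines a transvection along `b - a` sending `a` to `b`.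
  have hab : a ∉ F ∙ (b - a) := by
    intro h
    obtain ⟨c, hc⟩ := Submodule.mem_span_singleton.1 h
    have hcb : c • b = 0 := by
      refine hdisj ?_ (B.smul_mem c hb)
      have : c • b = a + c • a := by
        rw [smul_sub, sub_eq_iff_eq_add] at hc
        exact hc
      exact this ▸ A.add_mem ha (A.smul_mem c ha)
    rcases smul_eq_zero.1 hcb with rfl | h'
    · exact ha₀ (by simpa using hc.symm)
    · exact hb₀ h'
  obtain ⟨g, hga, hg⟩ := Submodule.exists_le_ker_of_notMem hab
  have hgv : ((g a)⁻¹ • g) (b - a) = 0 := by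
    have : g (b - a) = 0 := hg (Submodule.mem_span_singleton_self _)
    simp [LinearMap.smul_apply, this]
  let τ : M.E ≃ₗ[F] M.E := LinearEquiv.transvection hgv
  have hτ (x : M.E) : τ x = x + ((g a)⁻¹ • g) x • (b - a) := LinearMap.transvection.apply _ _ x
  have hD : b - a ∈ A ⊔ B :=
    Submodule.sub_mem _ (Submodule.mem_sup_right hb) (Submodule.mem_sup_left ha)
  refine ⟨τ, ?_, fun V => ?_⟩
  · rw [← eA, ← eB, Submodule.map_span, Set.image_singleton]
    congr 2
    refine (hτ a).trans ?_
    simp [hga]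
  -- Vectors move only by multiples of `b - a ∈ A + B`, so `V + A + B` is unchanged, as is `dim V`;
  -- these two determine the rank.
  · have e : V.map (τ : M.E →ₗ[F] M.E) ⊔ (A ⊔ B) = V ⊔ (A ⊔ B) := by
      refine le_antisymm (sup_le ?_ le_sup_right) (sup_le (fun x hx => ?_) le_sup_right)
      · rintro _ ⟨x, hx, rfl⟩
        exact (hτ x).symm ▸ Submodule.add_mem _ (Submodule.mem_sup_left hx)
          (Submodule.mem_sup_right (Submodule.smul_mem _ _ hD))
      · have h := Submodule.sub_mem (V.map (τ : M.E →ₗ[F] M.E) ⊔ (A ⊔ B))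
          (Submodule.mem_sup_left (Submodule.mem_map_of_mem hx))
          (Submodule.mem_sup_right (Submodule.smul_mem _ (((g a)⁻¹ • g) x) hD))
        rwa [LinearEquiv.coe_coe, hτ, add_sub_cancel_right] at h
    rw [hrank V, hrank (V.map (τ : M.E →ₗ[F] M.E)), e, LinearEquiv.finrank_map_eq]

/-! ### Cancellation and unique factorization -/

/-- The given isomorphism need not carry the first summand to the first summand. Composing it with
the automorphism `σ` corrects this, after which restriction and contraction recover both factors. -/
theorem freeProd_cancel {M₁ M₂ N₁ N₂ : QMatroid.{u, v} F} (hM : M₁.IsIrreducible)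
    (hN : N₁.IsIrreducible) (h : (freeProd M₁ M₂).Iso (freeProd N₁ N₂)) :
    M₁.Iso N₁ ∧ M₂.Iso N₂ := by
  obtain ⟨τ, hτ⟩ := h
  have hA := (isFreeSep_ker_snd M₁ M₂).map τ hτ
  have e₁ := (restrict_freeProd_iso M₁ M₂).symm.trans (restrict_iso_of_map_eq τ hτ rfl)
  have e₂ := (contract_freeProd_iso M₁ M₂).symm.trans (contract_iso_of_map_eq τ hτ rfl)
  have f₁ := restrict_freeProd_iso N₁ N₂
  obtain ⟨σ, hσ, hσ'⟩ := exists_automorphism hA (isFreeSep_ker_snd N₁ N₂) (hM.of_iso e₁)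
    (hN.of_iso f₁.symm)
  exact ⟨(e₁.trans (restrict_iso_of_map_eq σ hσ' hσ)).trans f₁,
    (e₂.trans (contract_iso_of_map_eq σ hσ' hσ)).trans (contract_freeProd_iso N₁ N₂)⟩

theorem isNontrivial_freeProdList {l : List (QMatroid.{u, v} F)} (hl : l ≠ [])
    (h : ∀ M ∈ l, M.IsIrreducible) : (freeProdList l).IsNontrivial := by
  match l, hl with
  | [M], _ => exact (h M (by simp)).1
  | M :: N :: l, _ =>
    have : Nontrivial M.E := (h M (by simp)).1
    exact (inferInstance : Nontrivial (M.E × (freeProdList (N :: l)).E))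

theorem not_iso_freeProdList_nil {l : List (QMatroid.{u, v} F)} (hl : l ≠ [])
    (h : ∀ M ∈ l, M.IsIrreducible) : ¬ (freeProdList l).Iso (freeProdList []) := by
  rintro ⟨τ, -⟩
  have : Nontrivial (freeProdList l).E := isNontrivial_freeProdList hl h
  have h' : Nontrivial PUnit.{v + 1} := τ.symm.toEquiv.nontrivial
  exact not_nontrivial _ h'

theorem forall₂_iso_of_freeProdList_iso (l l' : List (QMatroid.{u, v} F))
    (h : ∀ M ∈ l, M.IsIrreducible) (h' : ∀ M ∈ l', M.IsIrreducible)
    (e : (freeProdList l).Iso (freeProdList l')) : List.Forall₂ Iso l l' := by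
  induction l generalizing l' with
  | nil =>
    cases l' with
    | nil => exact .nil
    | cons N l' => exact absurd e.symm (not_iso_freeProdList_nil (by simp) h')
  | cons M l ih =>
    have hM := h M (by simp)
    match l, l' with
    | l, [] => exact absurd e (not_iso_freeProdList_nil (by simp) h)
    | [], [N] => exact .cons e .nil
    -- A one-term list is its factor itself, so a longer list would split an irreducible `q`-matroid
    -- into two nontrivial ones.
    | [], N :: N' :: l' =>
      exact absurd e (hM.2 _ _ (h' N (by simp)).1
        (isNontrivial_freeProdList (by simp) fun P hP => h' P (List.mem_cons_of_mem _ hP)))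
    | M' :: l, [N] =>
      exact absurd e.symm ((h' N (by simp)).2 _ _ hM.1
        (isNontrivial_freeProdList (by simp) fun P hP => h P (List.mem_cons_of_mem _ hP)))
    | M' :: l, N :: N' :: l' =>
      obtain ⟨e₁, e₂⟩ := freeProd_cancel hM (h' N (by simp)) e
      exact .cons e₁ (ih _ (fun P hP => h P (List.mem_cons_of_mem _ hP))
        (fun P hP => h' P (List.mem_cons_of_mem _ hP)) e₂)

end QMatroid

theorem mainTheorem7 {F : Type u} [Field F] [Finite F] (M : QMatroid.{u, v} F) (k r : ℕ)
    (Ms : Fin k → QMatroid.{u, v} F) (Ns : Fin r → QMatroid.{u, v} F)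
    (hMs : ∀ i, (Ms i).IsIrreducible) (hNs : ∀ j, (Ns j).IsIrreducible)
    (hM : M.Iso (QMatroid.freeProdList (List.ofFn Ms)))
    (hN : M.Iso (QMatroid.freeProdList (List.ofFn Ns))) :
    ∃ h : k = r, ∀ i : Fin k, (Ms i).Iso (Ns (Fin.cast h i)) := by
  have h := QMatroid.forall₂_iso_of_freeProdList_iso (List.ofFn Ms) (List.ofFn Ns)
    (by simpa [List.mem_ofFn] using hMs) (by simpa [List.mem_ofFn] using hNs) (hM.symm.trans hN)
  rw [List.forall₂_iff_get] at h
  obtain ⟨h₁, h₂⟩ := h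
  rw [List.length_ofFn, List.length_ofFn] at h₁
  subst h₁
  refine ⟨rfl, fun i => ?_⟩
  simpa using h₂ i.1 (by simp) (by simp)
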